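/- Let $n\ge 2$, $\tfrac12<a\le\tfrac34$, $b=2a-1$, and let $c>0$ and $c_0>0$. For $k\in\mathbb{N}$ put $$R_k=2^k,\qquad D_k=R_k^{\frac{n-(n-1)a+nb}{n+1}},\qquad Q_k=R_k^{\frac{n-1}{n+1}(2a-b-1)}.$$ For integers $p_1,\dots,p_n$ and $q\ge 1$, call $(p_1/q,\dots,p_n/q)$ an admissible fraction if $\gcd(p_1,q)=1$ and, for $2\le j\le n$, the $p_j$ are arbitrary when $q$ is odd, all even when $q\equiv 0 \pmod 4$, and all odd when $q\equiv 2\pmod 4$. Let $F_k\subset\mathbb{R}^n$ be the union of all closed axis-parallel boxes (slabs) with side lengths $cR_k^{-1/2}\times cR_k^{-1}\times\cdots\times cR_k^{-1}$ and center $$\Big(\frac{2p_1R_k}{qD_k^2},\ \frac{p_2}{D_kq},\ \dots,\ \frac{p_n}{D_kq}\Big),$$ where $(p_1/q,\dots,p_n/q)$ is an admissible fraction with $1\le q\le Q_k$. Let $F=\limsup_{k\to\infty}F_k=\bigcap_{N\ge 1}\bigcup_{k\ge N}F_k$ (a set of divergence of type I). Then the Hausdorff dimension satisfies $$\dim\big(F\cap[0,c_0]^n\big)\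 \ge\ \alpha:=\tfrac12+(n-1)a+b .$$ -/

import Mathlib

noncomputable section

/-- `(p₁/q, …, pₙ/q)` is an admissible fraction. The coordinates are numbered from `0`,
so `p₁` is the entry of `p` at the index with value `0`. -/
def AdmissibleFraction {n : ℕ} (p : Fin n → ℤ) (q : ℕ) : Prop :=
  (∀ i : Fin n, (i : ℕ) = 0 → IsCoprime (p i) (q : ℤ)) ∧
  (4 ∣ q → ∀ i : Fin n, (i : ℕ) ≠ 0 → Even (p i)) ∧
  (q % 4 = 2 → ∀ i : Fin n, (i : ℕ) ≠ 0 → Odd (p i))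

/-- The scale `R_k = 2 ^ k`. -/
def scaleR (k : ℕ) : ℝ := 2 ^ k

/-- `D_k = R_k ^ ((n - (n - 1) a + n b) / (n + 1))`. -/
def scaleD (n : ℕ) (a b : ℝ) (k : ℕ) : ℝ :=
  scaleR k ^ (((n : ℝ) - ((n : ℝ) - 1) * a + n * b) / ((n : ℝ) + 1))

/-- `Q_k = R_k ^ ((n - 1) / (n + 1) * (2 a - b - 1))`. -/
def scaleQ (n : ℕ) (a b : ℝ) (k : ℕ) : ℝ :=
  scaleR k ^ (((n : ℝ) - 1) / ((n : ℝ) + 1) * (2 * a - b - 1))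

/-- The point `(2 p₁ R_k / (q D_k²), p₂ / (D_k q), …, pₙ / (D_k q))`. -/
def slabCenter (n : ℕ) (a b : ℝ) (k : ℕ) (p : Fin n → ℤ) (q : ℕ) :
    EuclideanSpace ℝ (Fin n) :=
  WithLp.toLp 2 fun i =>
    if (i : ℕ) = 0 then 2 * (p i : ℝ) * scaleR k / ((q : ℝ) * scaleD n a b k ^ 2)
    else (p i : ℝ) / (scaleD n a b k * (q : ℝ))

/-- The closed axis-parallel slab with center `y` and side lengths
`c R_k ^ (-1/2), c R_k ^ (-1), …, c R_k ^ (-1)`. -/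
def slab (n : ℕ) (c : ℝ) (k : ℕ) (y : EuclideanSpace ℝ (Fin n)) :
    Set (EuclideanSpace ℝ (Fin n)) :=
  {x | ∀ i : Fin n,
    |x i - y i| ≤ c * scaleR k ^ (if (i : ℕ) = 0 then -(1 / 2 : ℝ) else -1) / 2}

/-- The collection `𝒜_k` of slabs. -/
def slabCollection (n : ℕ) (a b c : ℝ) (k : ℕ) : Set (Set (EuclideanSpace ℝ (Fin n))) :=
  {s | ∃ (p : Fin n → ℤ) (q : ℕ), 1 ≤ q ∧ (q : ℝ) ≤ scaleQ n a b k ∧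
    AdmissibleFraction p q ∧ s = slab n c k (slabCenter n a b k p q)}

/-- `F_k`, the union of the slabs of `𝒜_k`. -/
def divergenceLayer (n : ℕ) (a b c : ℝ) (k : ℕ) : Set (EuclideanSpace ℝ (Fin n)) :=
  ⋃₀ slabCollection n a b c k

/-- The `(a, b)`-set of divergence `F = limsup F_k = ⋂ N, ⋃ k ≥ N, F_k`. Since the upper limit
ignores finitely many indices, there is no need to specify the first index `k₀`. -/
def divergenceSet (n : ℕ) (a b c : ℝ) : Set (EuclideanSpace ℝ (Fin n)) :=
  ⋂ N : ℕ, ⋃ k ≥ N, divergenceLayer n a b c k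

end

/-!
Since `b = 2 a - 1`, the exponent of `Q_k` is zero and that of `D_k` is `a`. Hence `Q_k = 1`, only
the denominator `q = 1` occurs, and every integer vector is admissible: the layer `F_k` is a product
of neighbourhoods of lattices. Its first factor has spacing `2 R_k ^ (1 - 2 a)` and width
`c R_k ^ (-1/2)`, each of the others has spacing `R_k ^ (-a)` and width `c R_k ^ (-1)`
(`mem_divergenceLayer`).

For a sparse sequence of scales `k_0, k_1, …` with `k_{j+1} = H k_j` and `H` large, the intersection
of the layers `F_{k_j}` is contained in the limsup set, and it contains a product of `n` Cantor sets
on the line. Each Cantor set carries the probability measure that is the law of a point with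
independent uniform digits, and the mass of an interval is bounded by counting the lattice points
near it (`exists_cantor_measure`). Because the scales are sparse, the measure at scale
`R = R_{k_j}` looks, up to a factor `R ^ ε`, like Lebesgue measure renormalized on the lattice
intervals of this scale (`exists_cantor_measure_rpow`).

Multiplying the bounds of the `n` coordinates gives `μ (B (x, r)) ≤ C r ^ (α - τ)` for the product
measure. With `r = 2 ^ (-u)` this is a comparison of piecewise linear functions of `u`
(`exponent_le`); it is sharp for `r = R ^ (-1)`. The mass distribution principle
(`le_dimH_of_measure_closedBall_le`) then gives dimension at least `α - τ` for every `τ > 0`.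
-/

open MeasureTheory Filter ProbabilityTheory
open scoped Topology ENNReal

/-! ### The mass distribution principle -/

/-- **Mass distribution principle**: a set of positive measure, for a measure whose small balls of
radius `r` have mass `O(r ^ s)`, has Hausdorff dimension at least `s`. -/
theorem le_dimH_of_measure_closedBall_le {X : Type*} [MetricSpace X] [MeasurableSpace X]
    [BorelSpace X] (μ : Measure X) {K : Set X} (hK : μ K ≠ 0) {s C r₀ : ℝ} (hs : 0 < s)
    (hC : 0 < C) (hr₀ : 0 < r₀)
    (h : ∀ x r, 0 < r → r ≤ r₀ → μ (Metric.closedBall x r) ≤ ENNReal.ofReal (C * r ^ s)) :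
    ENNReal.ofReal s ≤ dimH K := by
  have hC' : ENNReal.ofReal C ≠ 0 := by simpa using hC
  -- Singletons are null: the case of diameter zero.
  have hpt : ∀ x, μ {x} = 0 := by
    intro x
    have hlim : Tendsto (fun r : ℝ => ENNReal.ofReal (C * r ^ s)) (𝓝[>] 0) (𝓝 0) := by
      have : Tendsto (fun r : ℝ => ENNReal.ofReal (C * r ^ s)) (𝓝[>] 0)
          (𝓝 (ENNReal.ofReal (C * (0 : ℝ) ^ s))) := by
        refine ENNReal.tendsto_ofReal (Tendsto.const_mul C ?_)
        exact ((Real.continuous_rpow_const hs.le).tendsto 0).mono_left nhdsWithin_le_nhds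
      simpa [Real.zero_rpow hs.ne'] using this
    refine le_antisymm (ge_of_tendsto hlim ?_) bot_le
    filter_upwards [Ioc_mem_nhdsGT hr₀] with r hr
    exact (measure_mono (by simpa using hr.1.le)).trans (h x r hr.1 hr.2)
  have hle : (ENNReal.ofReal C)⁻¹ • μ ≤ Measure.hausdorffMeasure s := by
    refine Measure.le_hausdorffMeasure s _ (ENNReal.ofReal r₀) (by simpa using hr₀) ?_
    intro t ht
    rcases t.eq_empty_or_nonempty with rfl | ⟨x, hx⟩
    · simp
    have hfin : Metric.ediam t ≠ ∞ := ne_top_of_le_ne_top ENNReal.ofReal_ne_top ht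
    have hsub : t ⊆ Metric.closedBall x (Metric.diam t) := fun y hy => by
      rw [Metric.mem_closedBall]
      exact Metric.dist_le_diam_of_mem' hfin hy hx
    rcases eq_or_lt_of_le (Metric.diam_nonneg (s := t)) with h0 | h0
    · have : μ t = 0 := by
        refine measure_mono_null hsub ?_
        rw [← h0, Metric.closedBall_zero]
        exact hpt x
      simp [this]
    · have hd : Metric.diam t ≤ r₀ := ENNReal.toReal_le_of_le_ofReal hr₀.le ht
      have h1 := (measure_mono hsub).trans (h x _ h0 hd)
      have h2 : Metric.ediam t = ENNReal.ofReal (Metric.diam t) :=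
        (ENNReal.ofReal_toReal hfin).symm
      rw [h2, ENNReal.ofReal_rpow_of_pos h0, Measure.smul_apply, smul_eq_mul]
      calc _ ≤ (ENNReal.ofReal C)⁻¹ * ENNReal.ofReal (C * Metric.diam t ^ s) := by gcongr
        _ = _ := by
          rw [ENNReal.ofReal_mul hC.le, ← mul_assoc,
            ENNReal.inv_mul_cancel hC' ENNReal.ofReal_ne_top, one_mul]
  have := le_dimH_of_hausdorffMeasure_ne_zero (s := K) (d := s.toNNReal) ?_
  · exact this
  · intro h0
    have h1 := hle K
    rw [Real.coe_toNNReal s hs.le] at h0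
    rw [h0] at h1
    simp [hK] at h1

/-! ### Cantor sets adapted to a sequence of lattices -/

/-- The left endpoint of the interval of generation `j` selected by the digits `ω`. The first
endpoint is `0`; the next one is obtained by moving to the first point of the lattice `δ j * ℤ` that
is not to the left of the present endpoint, and then by `ω j` further steps of length `δ j`. -/
noncomputable def cantorLeft (δ : ℕ → ℝ) {M : ℕ → ℕ} (ω : ∀ j, Fin (M j + 1)) : ℕ → ℝ
  | 0 => 0
  | j + 1 => δ j * ((⌈cantorLeft δ ω j / δ j⌉ : ℝ) + (ω j : ℕ))

/-- The point of the Cantor set with digits `ω`: the supremum of the increasing sequence of left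
endpoints. -/
noncomputable def cantorPoint (δ : ℕ → ℝ) {M : ℕ → ℕ} (ω : ∀ j, Fin (M j + 1)) : ℝ :=
  ⨆ j, cantorLeft δ ω j

section Cantor

variable {δ W : ℕ → ℝ} {M : ℕ → ℕ}

theorem cantorLeft_le_succ (hδ : ∀ j, 0 < δ j) (ω : ∀ j, Fin (M j + 1)) (j : ℕ) :
    cantorLeft δ ω j ≤ cantorLeft δ ω (j + 1) := by
  rw [cantorLeft]
  have h := Int.le_ceil (cantorLeft δ ω j / δ j)
  rw [div_le_iff₀' (hδ j)] at h
  have := hδ j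
  nlinarith [mul_nonneg this.le (Nat.cast_nonneg (α := ℝ) (ω j : ℕ))]

/-- The intervals are nested: with `W j` the length of the intervals of generation `j`, the
hypothesis `hMW` provides room for `M j + 1` children in each of them. -/
theorem cantorLeft_succ_add_le (hδ : ∀ j, 0 < δ j) (hW : ∀ j, W (j + 1) < δ j)
    (hMW : ∀ j, (M j + 2) * δ j ≤ W j) (ω : ∀ j, Fin (M j + 1)) (j : ℕ) :
    cantorLeft δ ω (j + 1) + W (j + 1) ≤ cantorLeft δ ω j + W j := by
  rw [cantorLeft]
  have h := (Int.ceil_lt_add_one (cantorLeft δ ω j / δ j)).le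
  have h2 : ((ω j : ℕ) : ℝ) ≤ M j := by exact_mod_cast Nat.lt_succ_iff.1 (ω j).2
  have h3 := mul_le_mul_of_nonneg_left (add_le_add h h2) (hδ j).le
  have h4 : δ j * (cantorLeft δ ω j / δ j + 1 + M j) = cantorLeft δ ω j + (M j + 1) * δ j := by
    have := (hδ j).ne'
    field_simp
    ring
  nlinarith [hW j, hMW j]

theorem cantorLeft_le_add (hδ : ∀ j, 0 < δ j) (hW : ∀ j, W (j + 1) < δ j)
    (hMW : ∀ j, (M j + 2) * δ j ≤ W j) (ω : ∀ j, Fin (M j + 1)) (i j : ℕ) :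
    cantorLeft δ ω i ≤ cantorLeft δ ω j + W j := by
  have hm : Monotone (cantorLeft δ ω) := monotone_nat_of_le_succ (cantorLeft_le_succ hδ ω)
  have ha : Antitone (fun j => cantorLeft δ ω j + W j) :=
    antitone_nat_of_succ_le (cantorLeft_succ_add_le hδ hW hMW ω)
  have hpos : 0 < W (max i j) :=
    lt_of_lt_of_le (mul_pos (by positivity) (hδ _)) (hMW _)
  linarith [hm (le_max_left i j), ha (le_max_right i j)]

theorem cantorPoint_mem (hδ : ∀ j, 0 < δ j) (hW : ∀ j, W (j + 1) < δ j)
    (hMW : ∀ j, (M j + 2) * δ j ≤ W j) (ω : ∀ j, Fin (M j + 1)) (j : ℕ) :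
    cantorPoint δ ω ∈ Set.Icc (cantorLeft δ ω j) (cantorLeft δ ω j + W j) :=
  ⟨le_ciSup ⟨_, Set.forall_mem_range.2 fun i => cantorLeft_le_add hδ hW hMW ω i 0⟩ j,
    ciSup_le fun i => cantorLeft_le_add hδ hW hMW ω i j⟩

theorem measurable_cantorLeft (j : ℕ) :
    Measurable fun ω : ∀ j, Fin (M j + 1) => cantorLeft δ ω j := by
  induction j with
  | zero => exact measurable_const
  | succ j ih =>
    have h1 : Measurable fun ω : ∀ j, Fin (M j + 1) => (⌈cantorLeft δ ω j / δ j⌉ : ℝ) :=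
      (measurable_from_top (f := fun z : ℤ => (z : ℝ))).comp
        (Int.measurable_ceil.comp (ih.div_const _))
    have h2 : Measurable fun ω : ∀ j, Fin (M j + 1) => (((ω j : ℕ)) : ℝ) :=
      (measurable_from_top (f := fun z : Fin (M j + 1) => ((z : ℕ) : ℝ))).comp
        (measurable_pi_apply j)
    exact (h1.add h2).const_mul _

theorem measurable_cantorPoint :
    Measurable fun ω : ∀ j, Fin (M j + 1) => cantorPoint δ ω :=
  Measurable.iSup measurable_cantorLeft

theorem exists_cantorLeft_succ_eq (ω : ∀ j, Fin (M j + 1)) (j : ℕ) :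
    ∃ m : ℤ, cantorLeft δ ω (j + 1) = m * δ j := by
  refine ⟨⌈cantorLeft δ ω j / δ j⌉ + (ω j : ℕ), ?_⟩
  rw [cantorLeft]
  push_cast
  ring

/-- An interval of generation `j` determines the first `j` digits. -/
theorem cantorLeft_injective (hδ : ∀ j, 0 < δ j) (hW : ∀ j, W (j + 1) < δ j)
    (hMW : ∀ j, (M j + 2) * δ j ≤ W j) (ω ω' : ∀ j, Fin (M j + 1)) (j : ℕ)
    (h : cantorLeft δ ω j = cantorLeft δ ω' j) : ∀ i < j, ω i = ω' i := by
  induction j with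
  | zero => intro i hi; omega
  | succ j ih =>
    -- Intervals of one generation are disjoint, so the parents agree.
    have hpar : cantorLeft δ ω j = cantorLeft δ ω' j := by
      cases j with
      | zero => rfl
      | succ j =>
        obtain ⟨m, hm⟩ := exists_cantorLeft_succ_eq (δ := δ) ω j
        obtain ⟨m', hm'⟩ := exists_cantorLeft_succ_eq (δ := δ) ω' j
        have hd := hδ j
        have a1 := cantorLeft_le_add hδ hW hMW ω (j + 2) (j + 1)
        have a2 := cantorLeft_le_succ hδ ω (j + 1)
        have b1 := cantorLeft_le_add hδ hW hMW ω' (j + 2) (j + 1)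
        have b2 := cantorLeft_le_succ hδ ω' (j + 1)
        have hw := hW j
        rw [hm] at a1 a2 ⊢
        rw [hm'] at b1 b2 ⊢
        have h1 : (m : ℝ) - m' < 1 := by
          by_contra hc
          nlinarith
        have h2 : (m' : ℝ) - m < 1 := by
          by_contra hc
          nlinarith
        have h1' : m - m' < 1 := by exact_mod_cast h1
        have h2' : m' - m < 1 := by exact_mod_cast h2
        have : m = m' := by omega
        rw [this]
    intro i hi
    rcases Nat.lt_succ_iff_lt_or_eq.1 hi with hi | rfl
    · exact ih hpar i hi
    · rw [cantorLeft, cantorLeft, hpar] at h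
      have := add_left_cancel (mul_left_cancel₀ (hδ i).ne' h)
      exact Fin.ext (by exact_mod_cast this)

variable (M) in
/-- The law of independent digits, the `j`-th one uniform on `Fin (M j + 1)`. -/
noncomputable def digitMeasure : Measure (∀ j, Fin (M j + 1)) :=
  Measure.infinitePi fun j => uniformOn (Set.univ : Set (Fin (M j + 1)))

instance : IsProbabilityMeasure (digitMeasure M) := by
  unfold digitMeasure
  infer_instance

theorem digitMeasure_cantorLeft_eq_le (hδ : ∀ j, 0 < δ j) (hW : ∀ j, W (j + 1) < δ j)
    (hMW : ∀ j, (M j + 2) * δ j ≤ W j) (j : ℕ) (z : ℝ) :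
    digitMeasure M {ω | cantorLeft δ ω j = z} ≤
      ENNReal.ofReal (∏ i ∈ Finset.range j, ((M i : ℝ) + 1))⁻¹ := by
  rcases Set.eq_empty_or_nonempty {ω : ∀ j, Fin (M j + 1) | cantorLeft δ ω j = z} with h | ⟨ω₀, h₀⟩
  · rw [h]; simp
  have hsub : {ω : ∀ j, Fin (M j + 1) | cantorLeft δ ω j = z} ⊆
      Set.pi (Finset.range j : Set ℕ) fun i => {ω₀ i} := fun ω hω i hi => by
    rw [Set.mem_ofPred_eq] at hω h₀
    exact cantorLeft_injective hδ hW hMW ω ω₀ j (hω.trans h₀.symm) i (by simpa using hi)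
  refine (measure_mono hsub).trans ?_
  rw [digitMeasure, Measure.infinitePi_pi _ (fun i _ => measurableSet_singleton _),
    ← Finset.prod_inv_distrib, ENNReal.ofReal_prod_of_nonneg (fun i _ => by positivity)]
  refine Finset.prod_le_prod' fun i _ => ?_
  rw [uniformOn_univ, Measure.count_singleton, Fintype.card_fin,
    ENNReal.ofReal_inv_of_pos (by positivity), one_div]
  rw [← Nat.cast_succ, ENNReal.ofReal_natCast]

/-- A ball of radius `r` meets at most `2 * r / δ j + 2` intervals of generation `j + 1`, and each of
them has mass at most `∏ i ∈ range (j + 1), (M i + 1)⁻¹`. -/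
theorem digitMeasure_cantorPoint_mem_closedBall_le (hδ : ∀ j, 0 < δ j)
    (hW : ∀ j, W (j + 1) < δ j)
    (hMW : ∀ j, (M j + 2) * δ j ≤ W j) (j : ℕ) (y r : ℝ) (hr : 0 ≤ r) :
    digitMeasure M {ω | cantorPoint δ ω ∈ Metric.closedBall y r} ≤
      ENNReal.ofReal ((2 * r / δ j + 2) * (∏ i ∈ Finset.range (j + 1), ((M i : ℝ) + 1))⁻¹) := by
  set lo : ℝ := (y - r - W (j + 1)) / δ j
  set hi : ℝ := (y + r) / δ j
  have hd := hδ j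
  have hsub : {ω : ∀ j, Fin (M j + 1) | cantorPoint δ ω ∈ Metric.closedBall y r} ⊆
      ⋃ m ∈ Finset.Icc ⌈lo⌉ ⌊hi⌋, {ω | cantorLeft δ ω (j + 1) = m * δ j} := by
    intro ω hω
    rw [Set.mem_ofPred_eq, Real.closedBall_eq_Icc] at hω
    obtain ⟨m, hm⟩ := exists_cantorLeft_succ_eq (δ := δ) ω j
    have hp := cantorPoint_mem hδ hW hMW ω (j + 1)
    simp only [Set.mem_iUnion, Finset.mem_Icc]
    refine ⟨m, ⟨?_, ?_⟩, hm⟩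
    · rw [Int.ceil_le, div_le_iff₀ hd, ← hm]
      linarith [hω.1, hp.2]
    · rw [Int.le_floor, le_div_iff₀ hd, ← hm]
      linarith [hω.2, hp.1]
  have hcard : (((Finset.Icc ⌈lo⌉ ⌊hi⌋).card : ℕ) : ℝ) ≤ 2 * r / δ j + 2 := by
    rw [Int.card_Icc]
    have h1 : hi - lo ≤ 2 * r / δ j + 1 := by
      have : hi - lo = 2 * r / δ j + W (j + 1) / δ j := by
        simp only [hi, lo]; ring
      rw [this]
      gcongr
      rw [div_le_one hd]
      exact (hW j).le
    have h2 : (0 : ℝ) ≤ 2 * r / δ j + 2 := by positivity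
    have h3 : ((⌊hi⌋ + 1 - ⌈lo⌉ : ℤ) : ℝ) ≤ 2 * r / δ j + 2 := by
      push_cast
      linarith [Int.floor_le hi, Int.le_ceil lo]
    rcases le_total 0 (⌊hi⌋ + 1 - ⌈lo⌉) with h | h
    · have : (((⌊hi⌋ + 1 - ⌈lo⌉).toNat : ℤ) : ℝ) = ((⌊hi⌋ + 1 - ⌈lo⌉ : ℤ) : ℝ) := by
        rw [Int.toNat_of_nonneg h]
      rw [Int.cast_natCast] at this
      rw [this]
      exact h3
    · rw [Int.toNat_of_nonpos h]
      simpa using h2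
  calc _ ≤ digitMeasure M (⋃ m ∈ Finset.Icc ⌈lo⌉ ⌊hi⌋, {ω | cantorLeft δ ω (j + 1) = m * δ j}) :=
        measure_mono hsub
    _ ≤ ∑ m ∈ Finset.Icc ⌈lo⌉ ⌊hi⌋, digitMeasure M {ω | cantorLeft δ ω (j + 1) = m * δ j} :=
        measure_biUnion_finset_le _ _
    _ ≤ ∑ m ∈ Finset.Icc ⌈lo⌉ ⌊hi⌋,
          ENNReal.ofReal (∏ i ∈ Finset.range (j + 1), ((M i : ℝ) + 1))⁻¹ :=
        Finset.sum_le_sum fun m _ => digitMeasure_cantorLeft_eq_le hδ hW hMW _ _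
    _ ≤ _ := by
        rw [Finset.sum_const, nsmul_eq_mul, ENNReal.ofReal_mul (by positivity)]
        gcongr
        rw [← ENNReal.ofReal_natCast]
        exact ENNReal.ofReal_le_ofReal hcard

end Cantor

/-- Given lattice spacings `δ j` and interval lengths `W (j + 1) < δ j`, with the intervals of one
generation at least four times as long as the next spacing, there is a probability measure
concentrated on the points of `[0, W 0]` that lie in a lattice interval of every generation. The
product in the bound controls its density at the resolution `δ j`: passing to generation `j + 1`
multiplies the density by about `δ j / W (j + 1)`, and the factor `2` covers the rounding of the
number of children. -/
theorem exists_cantor_measure {δ W : ℕ → ℝ} (hδ : ∀ j, 0 < δ j) (hW : ∀ j, W (j + 1) < δ j)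
    (hδW : ∀ j, 4 * δ j ≤ W j) :
    ∃ μ : Measure ℝ, IsProbabilityMeasure μ ∧
      1 ≤ μ {x | x ∈ Set.Icc 0 (W 0) ∧
        ∀ j, ∃ m : ℤ, x ∈ Set.Icc (m * δ j) (m * δ j + W (j + 1))} ∧
      ∀ (j : ℕ) (y r : ℝ), 0 ≤ r → μ (Metric.closedBall y r) ≤
        ENNReal.ofReal
          (4 * (r + δ j) * ((W 0)⁻¹ * ∏ i ∈ Finset.range j, 2 * δ i / W (i + 1))) := by
  have hW0 : ∀ j, 0 < W j := fun j => by linarith [hδ j, hδW j]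
  -- An interval of length `W j` has room for `⌊W j / δ j⌋ - 1 = M j + 1` children.
  let M : ℕ → ℕ := fun j => ⌊W j / δ j⌋₊ - 2
  have hM : ∀ j, (M j : ℝ) + 2 = ⌊W j / δ j⌋₊ := by
    intro j
    have : 2 ≤ ⌊W j / δ j⌋₊ := by
      apply Nat.le_floor
      rw [le_div_iff₀ (hδ j)]
      push_cast
      linarith [hδ j, hδW j]
    have h2 : M j + 2 = ⌊W j / δ j⌋₊ := by simp only [M]; omega
    exact_mod_cast h2
  have hMW : ∀ j, (M j + 2) * δ j ≤ W j := fun j => by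
    rw [hM, ← le_div_iff₀ (hδ j)]
    exact Nat.floor_le (div_pos (hW0 j) (hδ j)).le
  have hWM : ∀ j, W j ≤ 2 * δ j * (M j + 1) := fun j => by
    have h1 := Nat.lt_floor_add_one (W j / δ j)
    rw [← hM, div_lt_iff₀ (hδ j)] at h1
    nlinarith [hδ j, hδW j]
  have hmeas := measurable_cantorPoint (δ := δ) (M := M)
  refine ⟨(digitMeasure M).map (cantorPoint δ), Measure.isProbabilityMeasure_map hmeas.aemeasurable,
    ?_, ?_⟩
  · refine le_trans ?_ (Measure.le_map_apply hmeas.aemeasurable _)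
    rw [← measure_univ (μ := digitMeasure M)]
    refine measure_mono fun ω _ => ⟨?_, fun j => ?_⟩
    · simpa [cantorLeft] using cantorPoint_mem hδ hW hMW ω 0
    · obtain ⟨m, hm⟩ := exists_cantorLeft_succ_eq (δ := δ) ω j
      exact ⟨m, hm ▸ cantorPoint_mem hδ hW hMW ω (j + 1)⟩
  · intro j y r hr
    rw [Measure.map_apply hmeas Metric.isClosed_closedBall.measurableSet]
    refine (digitMeasure_cantorPoint_mem_closedBall_le hδ hW hMW j y r hr).trans
      (ENNReal.ofReal_le_ofReal ?_)
    have hP : ∀ j, 0 < ∏ i ∈ Finset.range j, ((M i : ℝ) + 1) := fun j =>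
      Finset.prod_pos fun i _ => by positivity
    -- The mass of an interval of generation `j` over its length is at most the density.
    have key : ∀ j, ((∏ i ∈ Finset.range j, ((M i : ℝ) + 1)) * W j)⁻¹ ≤
        (W 0)⁻¹ * ∏ i ∈ Finset.range j, 2 * δ i / W (i + 1) := by
      intro j
      induction j with
      | zero => simp
      | succ j ih =>
        rw [Finset.prod_range_succ, Finset.prod_range_succ, ← mul_assoc]
        have h1 := hW0 j
        have h2 := hW0 (j + 1)
        have h3 := hP j
        refine le_trans ?_ (mul_le_mul_of_nonneg_right ih
          (div_nonneg (mul_nonneg zero_le_two (hδ j).le) h2.le))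
        rw [inv_mul_eq_div, div_div, inv_eq_one_div, div_le_div_iff₀ (by positivity)
          (by positivity)]
        nlinarith [mul_le_mul_of_nonneg_left (hWM j) (mul_pos h3 h2).le]
    have h1 := hW0 j
    have h3 := hP j
    have h4 := hδ j
    refine le_trans ?_ (mul_le_mul_of_nonneg_left (key j) (by positivity))
    rw [Finset.prod_range_succ, ← div_eq_mul_inv, ← div_eq_mul_inv,
      div_le_div_iff₀ (by positivity) (by positivity)]
    have h5 : 4 * (r + δ j) = 2 * ((2 * r / δ j + 2) * δ j) := by field_simp; ring
    have h6 : 0 ≤ 2 * r / δ j + 2 := by positivity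
    rw [h5]
    linarith [mul_le_mul_of_nonneg_left (hWM j) (mul_nonneg h6 h3.le)]

/-! ### Sparse scales -/

/-- The Cantor measure of `exists_cantor_measure` at the scales `R = 2 ^ k j`, with spacings
`κ * R ^ (-d)` and interval lengths `γ * R ^ (-e)`. If `k` grows fast enough, all constants and all
earlier scales cost at most a factor `R ^ ε`, so that the density below the scale `k j` is at most
`R ^ (e - d + ε)`. -/
theorem exists_cantor_measure_rpow {d e ε κ γ L g : ℝ} {k : ℕ → ℝ} (hde : d ≤ e)
    (hκ : 1 ≤ κ) (hκ' : κ ≤ 2) (hγ : 0 < γ) (hγ' : γ < 1)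
    (hk : ∀ j, 0 ≤ k j) (hgL : (2 : ℝ) ^ (-g) ≤ L) (hgγ : 4 * (2 : ℝ) ^ (-g) ≤ γ)
    (h0 : g + 3 ≤ d * k 0) (h1 : 2 * g ≤ ε * k 0)
    (h2 : ∀ j, e * k j + g + 3 ≤ d * k (j + 1))
    (h3 : ∀ j, (e - d + ε) * k j + g ≤ ε * k (j + 1)) :
    ∃ μ : Measure ℝ, IsProbabilityMeasure μ ∧
      1 ≤ μ {x | x ∈ Set.Icc 0 L ∧ ∀ j, ∃ m : ℤ, x ∈ Set.Icc (m * (κ * 2 ^ (-(d * k j))))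
        (m * (κ * 2 ^ (-(d * k j))) + γ * 2 ^ (-(e * k j)))} ∧
      ∀ (j : ℕ) (y u : ℝ), μ (Metric.closedBall y (2 ^ (-u))) ≤
        ENNReal.ofReal (2 ^ (4 - min u (d * k (j + 1)) + (e - d + ε) * k j)) := by
  have two : (0 : ℝ) < 2 := two_pos
  let δ : ℕ → ℝ := fun j => κ * 2 ^ (-(d * k j))
  let W : ℕ → ℝ := fun j => Nat.casesOn j L fun i => γ * 2 ^ (-(e * k i))
  have hδ : ∀ j, 0 < δ j := fun j => by positivity
  have hδ2 : ∀ j, δ j ≤ 2 * 2 ^ (-(d * k j)) := fun j => by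
    simp only [δ]
    gcongr
  have hW : ∀ j, W (j + 1) < δ j := fun j => by
    simp only [W, δ]
    have a1 : (2 : ℝ) ^ (-(e * k j)) ≤ 2 ^ (-(d * k j)) :=
      Real.rpow_le_rpow_of_exponent_le one_le_two (by nlinarith [hk j])
    have a2 : (0 : ℝ) < 2 ^ (-(e * k j)) := by positivity
    nlinarith
  have h8 : (2 : ℝ) ^ (3 : ℝ) = 8 := by norm_num
  have hδW : ∀ j, 4 * δ j ≤ W j := fun j => by
    cases j with
    | zero =>
      calc 4 * δ 0 ≤ 2 ^ (3 : ℝ) * 2 ^ (-(d * k 0)) := by linarith [hδ2 0]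
        _ = 2 ^ (3 - d * k 0) := by rw [← Real.rpow_add two]; rfl
        _ ≤ 2 ^ (-g) := Real.rpow_le_rpow_of_exponent_le one_le_two (by linarith)
        _ ≤ L := hgL
    | succ j =>
      have hg2 : (2 : ℝ) ^ (-g) ≤ γ := by
        have : (0 : ℝ) < 2 ^ (-g) := by positivity
        linarith
      calc 4 * δ (j + 1) ≤ 2 ^ (3 : ℝ) * 2 ^ (-(d * k (j + 1))) := by linarith [hδ2 (j + 1)]
        _ = 2 ^ (3 - d * k (j + 1)) := by rw [← Real.rpow_add two]; rfl
        _ ≤ 2 ^ (-g + -(e * k j)) :=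
          Real.rpow_le_rpow_of_exponent_le one_le_two (by linarith [h2 j])
        _ = 2 ^ (-g) * 2 ^ (-(e * k j)) := Real.rpow_add two _ _
        _ ≤ γ * 2 ^ (-(e * k j)) := by gcongr
  obtain ⟨μ, hμ, hK, hball⟩ := exists_cantor_measure hδ hW hδW
  refine ⟨μ, hμ, hK, fun j y u => (hball (j + 1) y _ (by positivity)).trans
    (ENNReal.ofReal_le_ofReal ?_)⟩
  have hfac : ∀ i, 2 * δ i / W (i + 1) ≤ 2 ^ (g + (e - d) * k i) := fun i => by
    have a0 : (0 : ℝ) < 2 ^ (-(e * k i)) := by positivity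
    have a1 : (2 : ℝ) ^ (g + (e - d) * k i) * (2 ^ (-g) * 2 ^ (-(e * k i))) =
        2 ^ (-(d * k i)) := by
      rw [← Real.rpow_add two, ← Real.rpow_add two]
      congr 1
      ring
    rw [div_le_iff₀ (by simp only [W]; positivity)]
    calc 2 * δ i ≤ 4 * 2 ^ (-(d * k i)) := by linarith [hδ2 i]
      _ = (2 : ℝ) ^ (g + (e - d) * k i) * (4 * 2 ^ (-g) * 2 ^ (-(e * k i))) := by
        rw [← a1]; ring
      _ ≤ (2 : ℝ) ^ (g + (e - d) * k i) * (γ * 2 ^ (-(e * k i))) := by gcongr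
  have hW0 : ∀ j, 0 < W j := fun j => by linarith [hδ j, hδW j]
  have hnn : ∀ i, 0 ≤ 2 * δ i / W (i + 1) := fun i =>
    div_nonneg (mul_nonneg zero_le_two (hδ i).le) (hW0 (i + 1)).le
  -- The density at the resolution `δ j` is `2 ^ (ε * k j)` with a factor `2 ^ (-g)` to spare; the
  -- factor is used up by the constants of one step, and the growth of `k` restores it.
  have hρ : ∀ j, (W 0)⁻¹ * ∏ i ∈ Finset.range j, 2 * δ i / W (i + 1) ≤ 2 ^ (ε * k j - g) ∧
      (W 0)⁻¹ * ∏ i ∈ Finset.range (j + 1), 2 * δ i / W (i + 1) ≤ 2 ^ ((e - d + ε) * k j) := by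
    have step : ∀ j, (W 0)⁻¹ * ∏ i ∈ Finset.range j, 2 * δ i / W (i + 1) ≤ 2 ^ (ε * k j - g) →
      (W 0)⁻¹ * ∏ i ∈ Finset.range (j + 1), 2 * δ i / W (i + 1) ≤ 2 ^ ((e - d + ε) * k j) := by
      intro j h
      rw [Finset.prod_range_succ, ← mul_assoc]
      calc _ ≤ (2 : ℝ) ^ (ε * k j - g) * 2 ^ (g + (e - d) * k j) :=
            mul_le_mul h (hfac j) (hnn j) (by positivity)
        _ = _ := by
          rw [← Real.rpow_add two]
          congr 1
          ring
    intro j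
    induction j with
    | zero =>
      have : (W 0)⁻¹ * ∏ i ∈ Finset.range 0, 2 * δ i / W (i + 1) ≤ 2 ^ (ε * k 0 - g) := by
        rw [Finset.prod_range_zero, mul_one]
        calc (W 0)⁻¹ ≤ (2 ^ (-g))⁻¹ := inv_anti₀ (by positivity) hgL
          _ = 2 ^ g := by rw [Real.rpow_neg two.le, inv_inv]
          _ ≤ _ := Real.rpow_le_rpow_of_exponent_le one_le_two (by linarith)
      exact ⟨this, step 0 this⟩
    | succ j ih =>
      have := ih.2.trans (Real.rpow_le_rpow_of_exponent_le (z := ε * k (j + 1) - g) one_le_two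
        (by linarith [h3 j]))
      exact ⟨this, step _ this⟩
  have b1 : (2 : ℝ) ^ (-u) ≤ 2 ^ (-min u (d * k (j + 1))) :=
    Real.rpow_le_rpow_of_exponent_le one_le_two (neg_le_neg (min_le_left _ _))
  have b2 : (2 : ℝ) ^ (-(d * k (j + 1))) ≤ 2 ^ (-min u (d * k (j + 1))) :=
    Real.rpow_le_rpow_of_exponent_le one_le_two (neg_le_neg (min_le_right _ _))
  have b3 : (0 : ℝ) < 2 ^ (-min u (d * k (j + 1))) := by positivity
  have b4 : 4 * (2 ^ (-u) + δ (j + 1)) ≤ 2 ^ (4 - min u (d * k (j + 1))) := by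
    rw [sub_eq_add_neg, Real.rpow_add two]
    have : (2 : ℝ) ^ (4 : ℝ) = 16 := by norm_num
    rw [this]
    linarith [hδ2 (j + 1)]
  rw [Real.rpow_add two]
  exact mul_le_mul b4 (hρ j).2
    (mul_nonneg (inv_nonneg.2 (hW0 0).le) (Finset.prod_nonneg fun i _ => hnn i)) (by positivity)

/-- The sequence `K * H ^ j` with large `K` and `H` satisfies all the growth conditions. -/
theorem exists_lacunary_scales {η ε g : ℝ} (hη : 0 < η) (hη1 : η ≤ 1) (hε : 0 < ε) (hg : 0 ≤ g) :
    ∃ k : ℕ → ℕ, (∀ j, j ≤ k j) ∧ g + 3 ≤ η * k 0 ∧ 2 * g ≤ ε * k 0 ∧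
      (∀ j, k j + g + 3 ≤ η * k (j + 1)) ∧ ∀ j, (1 + ε) * k j + g ≤ ε * k (j + 1) := by
  obtain ⟨K, hK⟩ := exists_nat_ge (max ((g + 3) / η) (2 * g / ε))
  obtain ⟨H, hH⟩ := exists_nat_ge (max (2 / η) ((1 + 2 * ε) / ε))
  have hK1 := (div_le_iff₀' hη).1 ((le_max_left _ _).trans hK)
  have hK2 := (div_le_iff₀' hε).1 ((le_max_right _ _).trans hK)
  have hH1 := (div_le_iff₀' hη).1 ((le_max_left _ _).trans hH)
  have hH2 := (div_le_iff₀' hε).1 ((le_max_right _ _).trans hH)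
  have hHnat : 2 ≤ H := by
    have : (2 : ℝ) ≤ H := by nlinarith [Nat.cast_nonneg (α := ℝ) H]
    exact_mod_cast this
  have hKnat : 1 ≤ K := by
    rw [Nat.one_le_iff_ne_zero]
    rintro rfl
    simp at hK1
    linarith
  have hKk : ∀ j, (K : ℝ) ≤ ((K * H ^ j : ℕ) : ℝ) := fun j => by
    exact_mod_cast Nat.le_mul_of_pos_right K (by positivity)
  have hsucc : ∀ j, ((K * H ^ (j + 1) : ℕ) : ℝ) = H * ((K * H ^ j : ℕ) : ℝ) := fun j => by
    push_cast
    ring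
  have hpos : ∀ j, (0 : ℝ) ≤ ((K * H ^ j : ℕ) : ℝ) := fun j => Nat.cast_nonneg _
  refine ⟨fun j => K * H ^ j, fun j => ?_, by simpa using hK1, by simpa using hK2, fun j => ?_,
    fun j => ?_⟩
  · exact ((Nat.lt_pow_self hHnat).le).trans (Nat.le_mul_of_pos_left _ hKnat)
  · rw [hsucc]
    nlinarith [mul_le_mul_of_nonneg_right hH1 (hpos j), hKk j]
  · rw [hsucc]
    nlinarith [mul_le_mul_of_nonneg_right hH2 (hpos j), hKk j]

/-! ### Comparison of exponents -/

/-- The logarithmic form of the estimate for a ball of radius `2 ^ (-u)`, when `S ≤ u ≤ K` for two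
consecutive scales `S` and `K` and the dimension of the space is `m + 1`. The two alternatives bound
the mass in the first coordinate at the resolution of `K` and at that of the next scale; the bound
at the resolution of `K` is used in the `m` other coordinates. -/
theorem exponent_le {m a ε τ S K u : ℝ} (hm : 1 ≤ m) (ha : 1 / 2 < a) (ha' : a ≤ 3 / 4)
    (hε : 0 ≤ ε) (hτ : (m + 1) * ε = τ * (2 * a - 1)) (hS : 0 ≤ S) (hSu : S ≤ u) (huK : u ≤ K)
    (hSK : (1 + ε) * S ≤ ε * K) :
    (4 - min u ((2 * a - 1) * K) + (1 / 2 - (2 * a - 1) + ε) * S) +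
        m * (4 - min u (a * K) + (1 - a + ε) * S) ≤
      4 * (m + 1) - (1 / 2 + m * a + (2 * a - 1) - τ) * u ∨
    (4 - u + (1 / 2 - (2 * a - 1) + ε) * K) + m * (4 - min u (a * K) + (1 - a + ε) * S) ≤
      4 * (m + 1) - (1 / 2 + m * a + (2 * a - 1) - τ) * u := by
  have hK : 0 ≤ K := by linarith
  have hu : 0 ≤ u := by linarith
  have hτ0 : 0 ≤ τ := by
    by_contra h
    nlinarith
  have hετ : (m + 1) * ε ≤ τ := by nlinarith
  rcases le_total u ((2 * a - 1) * K) with hcase | hcase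
  · -- The ball is longer than all the gaps of the scale `K`.
    left
    have h1 : u ≤ a * K := by nlinarith
    rw [min_eq_left hcase, min_eq_left h1]
    have h2 : 0 ≤ (3 / 2 - 2 * a) + m * (1 - a) + (m + 1) * ε := by
      have := mul_nonneg (by linarith : (0 : ℝ) ≤ m) (by linarith : (0 : ℝ) ≤ 1 - a)
      nlinarith
    nlinarith [mul_le_mul_of_nonneg_left hSu h2, mul_le_mul_of_nonneg_right hετ hu]
  · -- The contribution of earlier scales is at most `τ * u`.
    have hloss : (m + 1) * (ε * K) ≤ τ * u := by
      nlinarith [mul_le_mul_of_nonneg_left hcase hτ0]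
    have hA : (1 / 2 - (2 * a - 1) + ε) * S ≤ ε * K := by nlinarith
    have hB : m * ((1 - a + ε) * S) ≤ m * (ε * K) :=
      mul_le_mul_of_nonneg_left (by nlinarith) (by linarith)
    -- The radius is compared with the length of the first side and the gaps of the other sides.
    rcases le_total u (K / 2) with hcase2 | hcase2
    · left
      have h1 : u ≤ a * K := by nlinarith
      rw [min_eq_right hcase, min_eq_left h1]
      have h2 : (1 / 2 + m * a + (2 * a - 1) - m) * u ≤ (2 * a - 1) * K := by
        have : 1 / 2 + m * a + (2 * a - 1) - m ≤ 2 * (2 * a - 1) := by nlinarith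
        nlinarith
      nlinarith
    · right
      rcases le_total u (a * K) with hcase3 | hcase3
      · rw [min_eq_left hcase3]
        have h2 : (3 / 2 - 2 * a) * K ≤ (m * (1 - a) + (3 / 2 - 2 * a)) * u := by
          have : 2 * (3 / 2 - 2 * a) ≤ m * (1 - a) + (3 / 2 - 2 * a) := by nlinarith
          nlinarith
        nlinarith
      · rw [min_eq_right hcase3]
        have h2 : (1 / 2 + m * a + (2 * a - 1) - 1) * u ≤
            (1 / 2 + m * a + (2 * a - 1) - 1) * K :=
          mul_le_mul_of_nonneg_left huK (by nlinarith)
        nlinarith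

/-! ### The divergence set -/

theorem scaleD_eq (n : ℕ) (a : ℝ) (k : ℕ) : scaleD n a (2 * a - 1) k = 2 ^ (a * k) := by
  have h : ((n : ℝ) - ((n : ℝ) - 1) * a + n * (2 * a - 1)) / ((n : ℝ) + 1) = a := by
    field_simp
    ring
  rw [scaleD, h, scaleR, ← Real.rpow_natCast, ← Real.rpow_mul zero_le_two, mul_comm]

theorem scaleQ_eq (n : ℕ) (a : ℝ) (k : ℕ) : scaleQ n a (2 * a - 1) k = 1 := by
  rw [scaleQ]
  ring_nf
  simp

/-- The denominator `q = 1` suffices: a point whose coordinates lie to the right of lattice points,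
within half the side length of a slab, belongs to the layer. -/
theorem mem_divergenceLayer {n : ℕ} {a c γ : ℝ} (hγ : γ ≤ c / 2) {k : ℕ}
    {x : EuclideanSpace ℝ (Fin n)}
    (hx : ∀ i : Fin n, ∃ m : ℤ, x i ∈ Set.Icc
      (m * ((if (i : ℕ) = 0 then 2 else 1) *
        (2 : ℝ) ^ (-((if (i : ℕ) = 0 then 2 * a - 1 else a) * k))))
      (m * ((if (i : ℕ) = 0 then 2 else 1) *
        (2 : ℝ) ^ (-((if (i : ℕ) = 0 then 2 * a - 1 else a) * k))) +
        γ * 2 ^ (-((if (i : ℕ) = 0 then 1 / 2 else 1) * (k : ℝ))))) :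
    x ∈ divergenceLayer n a (2 * a - 1) c k := by
  choose p hp using hx
  refine ⟨_, ⟨p, 1, le_rfl, by rw [scaleQ_eq]; simp, ⟨fun i _ => ?_, fun h => ?_, fun h => ?_⟩,
    rfl⟩, fun i => ?_⟩
  · simpa using isCoprime_one_right
  · omega
  · omega
  have hcenter : slabCenter n a (2 * a - 1) k p 1 i =
      p i * ((if (i : ℕ) = 0 then 2 else 1) *
        (2 : ℝ) ^ (-((if (i : ℕ) = 0 then 2 * a - 1 else a) * k))) := by
    have hD : (0 : ℝ) < 2 ^ (a * k) := by positivity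
    simp only [slabCenter, scaleD_eq]
    split_ifs
    · have h1 : (2 : ℝ) ^ (-((2 * a - 1) * k)) = scaleR k / (2 ^ (a * k)) ^ 2 := by
        rw [scaleR, ← Real.rpow_natCast 2 k, ← Real.rpow_natCast _ 2,
          ← Real.rpow_mul zero_le_two, ← Real.rpow_sub two_pos]
        congr 1
        push_cast
        ring
      rw [h1]
      push_cast
      ring
    · rw [Real.rpow_neg zero_le_two]
      push_cast
      field_simp
  have hwidth : γ * 2 ^ (-((if (i : ℕ) = 0 then 1 / 2 else 1) * (k : ℝ))) ≤
      c * scaleR k ^ (if (i : ℕ) = 0 then -(1 / 2 : ℝ) else -1) / 2 := by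
    have h1 : (2 : ℝ) ^ (-((if (i : ℕ) = 0 then 1 / 2 else 1) * (k : ℝ))) =
        scaleR k ^ (if (i : ℕ) = 0 then -(1 / 2 : ℝ) else -1) := by
      rw [scaleR, ← Real.rpow_natCast 2 k, ← Real.rpow_mul zero_le_two]
      congr 1
      split_ifs <;> ring
    rw [h1, mul_div_right_comm]
    have : 0 ≤ scaleR k ^ (if (i : ℕ) = 0 then -(1 / 2 : ℝ) else -1) :=
      Real.rpow_nonneg (by rw [scaleR]; positivity) _
    gcongr
  rw [hcenter, abs_of_nonneg (by linarith [(hp i).1])]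
  linarith [(hp i).2]

/-- The dimension bound with a loss `τ`, from a product of Cantor measures. -/
theorem le_dimH_divergenceSet {n : ℕ} (hn : 2 ≤ n) {a c c₀ τ : ℝ} (ha : 1 / 2 < a)
    (ha' : a ≤ 3 / 4) (hc : 0 < c) (hc₀ : 0 < c₀) (hτ : 0 < τ)
    (hs : 0 < 1 / 2 + ((n : ℝ) - 1) * a + (2 * a - 1) - τ) :
    ENNReal.ofReal (1 / 2 + ((n : ℝ) - 1) * a + (2 * a - 1) - τ) ≤
      dimH (divergenceSet n a (2 * a - 1) c ∩
        {x : EuclideanSpace ℝ (Fin n) | ∀ i, x i ∈ Set.Icc 0 c₀}) := by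
  obtain ⟨m, rfl⟩ : ∃ m, n = m + 1 := ⟨n - 1, by omega⟩
  have hm : (1 : ℝ) ≤ m := by exact_mod_cast (by omega : 1 ≤ m)
  push_cast at hs ⊢
  rw [add_sub_cancel_right] at hs ⊢
  obtain ⟨γ, hγ0, hγ1, hγc⟩ : ∃ γ : ℝ, 0 < γ ∧ γ < 1 ∧ γ ≤ c / 2 :=
    ⟨min (1 / 2) (c / 2), by positivity, (min_le_left _ _).trans_lt (by norm_num), min_le_right _ _⟩
  obtain ⟨g, hg⟩ := exists_pow_lt_of_lt_one (show 0 < min c₀ (γ / 4) by positivity)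
    (show (1 / 2 : ℝ) < 1 by norm_num)
  have hg' : (2 : ℝ) ^ (-(g : ℝ)) = (1 / 2) ^ g := by
    rw [Real.rpow_neg zero_le_two, Real.rpow_natCast]
    simp
  rw [← hg', lt_min_iff] at hg
  set η := 2 * a - 1 with hη
  have hη0 : 0 < η := by linarith
  -- The loss `R ^ ε` in each coordinate is absorbed by `r ^ (-τ)` for `r ≤ R ^ (-η)`.
  obtain ⟨ε, hε0, hετ⟩ : ∃ ε : ℝ, 0 < ε ∧ (m + 1) * ε = τ * η :=
    ⟨τ * η / (m + 1), by positivity, by field_simp⟩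
  obtain ⟨k, hkj, hk0, hk0', hk1, hk2⟩ :=
    exists_lacunary_scales hη0 (by linarith) hε0 (Nat.cast_nonneg (α := ℝ) g)
  have hk : ∀ j, (0 : ℝ) ≤ k j := fun j => Nat.cast_nonneg _
  -- One Cantor measure per coordinate, all built on the same sequence of scales.
  have hex := fun i : Fin (m + 1) => by
    have hκ1 : (1 : ℝ) ≤ if (i : ℕ) = 0 then 2 else 1 := by split_ifs <;> norm_num
    have hκ2 : (if (i : ℕ) = 0 then 2 else 1 : ℝ) ≤ 2 := by split_ifs <;> norm_num
    have hde : (if (i : ℕ) = 0 then η else a) ≤ if (i : ℕ) = 0 then (1 / 2 : ℝ) else 1 := by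
      split_ifs <;> linarith
    have hd : η ≤ if (i : ℕ) = 0 then η else a := by split_ifs <;> linarith
    have he : (if (i : ℕ) = 0 then 1 / 2 else 1 : ℝ) ≤ 1 := by split_ifs <;> norm_num
    exact exists_cantor_measure_rpow (ε := ε) (L := c₀) (g := g) (k := fun j => (k j : ℝ)) hde hκ1
      hκ2 hγ0 hγ1 hk hg.1.le (by linarith)
      (by nlinarith [hk 0]) hk0' (fun j => by nlinarith [hk j, hk (j + 1), hk1 j])
      (fun j => by nlinarith [hk j, hk2 j])
  choose μ hμ hK hball using hex
  set Kset : Fin (m + 1) → Set ℝ := fun i => {x | x ∈ Set.Icc 0 c₀ ∧ ∀ j, ∃ p : ℤ, x ∈ Set.Icc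
      (p * ((if (i : ℕ) = 0 then 2 else 1) *
        (2 : ℝ) ^ (-((if (i : ℕ) = 0 then η else a) * k j))))
      (p * ((if (i : ℕ) = 0 then 2 else 1) *
        (2 : ℝ) ^ (-((if (i : ℕ) = 0 then η else a) * k j))) +
        γ * 2 ^ (-((if (i : ℕ) = 0 then 1 / 2 else 1) * (k j : ℝ))))}
  have hsub : Set.pi Set.univ Kset ⊆ WithLp.ofLp '' (divergenceSet (m + 1) a η c ∩
        {x : EuclideanSpace ℝ (Fin (m + 1)) | ∀ i, x i ∈ Set.Icc 0 c₀}) := by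
    intro y hy
    refine ⟨WithLp.toLp 2 y, ⟨?_, fun i => (hy i (Set.mem_univ i)).1⟩, rfl⟩
    refine Set.mem_iInter.2 fun N => Set.mem_iUnion₂.2 ⟨k N, hkj N, ?_⟩
    exact mem_divergenceLayer hγc fun i => (hy i (Set.mem_univ i)).2 N
  refine le_trans ?_ ((PiLp.lipschitzWith_ofLp 2 (fun _ : Fin (m + 1) => ℝ)).dimH_image_le _)
  refine le_trans ?_ (dimH_mono hsub)
  refine le_dimH_of_measure_closedBall_le (Measure.pi μ) (C := 2 ^ (4 * ((m : ℝ) + 1)))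
    (r₀ := 2 ^ (-(k 0 : ℝ))) ?_ hs (by positivity) (by positivity) ?_
  · rw [Measure.pi_pi]
    exact Finset.prod_ne_zero_iff.2 fun i _ => (zero_lt_one.trans_le (hK i)).ne'
  intro y r hr hr0
  obtain ⟨u, rfl⟩ : ∃ u : ℝ, r = 2 ^ (-u) :=
    ⟨-Real.logb 2 r, by rw [neg_neg, Real.rpow_logb two_pos (by norm_num) hr]⟩
  have hu0 : (k 0 : ℝ) ≤ u := by
    have := (Real.rpow_le_rpow_left_iff one_lt_two).1 hr0
    linarith
  -- Locate the radius between two consecutive scales.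
  obtain ⟨j, hj1, hj2⟩ : ∃ j, (k j : ℝ) ≤ u ∧ u < k (j + 1) := by
    have hex : ∃ j, u < k j := by
      obtain ⟨j, hj⟩ := exists_nat_gt u
      exact ⟨j, hj.trans_le (by exact_mod_cast hkj j)⟩
    classical
    have hne : Nat.find hex ≠ 0 := fun h => by
      have := Nat.find_spec hex
      rw [h] at this
      linarith
    obtain ⟨j, hj⟩ := Nat.exists_eq_succ_of_ne_zero hne
    refine ⟨j, not_lt.1 (Nat.find_min hex (by omega)), ?_⟩
    have := Nat.find_spec hex
    rwa [hj] at this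
  rw [closedBall_pi _ hr.le, Measure.pi_pi, Fin.prod_univ_succ]
  have hB : ∏ i : Fin m, μ i.succ (Metric.closedBall (y i.succ) (2 ^ (-u))) ≤
      ENNReal.ofReal (2 ^ (m * (4 - min u (a * k (j + 1)) + (1 - a + ε) * k j))) := by
    refine (Finset.prod_le_prod' fun i _ => hball i.succ j (y i.succ) u).trans ?_
    simp only [Fin.val_succ, Nat.succ_ne_zero, if_false, Finset.prod_const, Finset.card_univ,
      Fintype.card_fin]
    rw [← ENNReal.ofReal_pow (by positivity), ← Real.rpow_natCast,
      ← Real.rpow_mul zero_le_two, mul_comm]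
  have hA1 := hball 0 j (y 0) u
  have hA2 := hball 0 (j + 1) (y 0) u
  simp only [Fin.val_zero, if_true] at hA1 hA2
  -- The gaps of the scale `k (j + 2)` are shorter than the radius.
  have hmin : u ≤ η * k (j + 1 + 1) := by
    have := hk1 (j + 1)
    have := Nat.cast_nonneg (α := ℝ) g
    linarith
  rw [min_eq_left hmin] at hA2
  have hcomb : ∀ {A B : ℝ} {x z : ℝ≥0∞}, x ≤ ENNReal.ofReal (2 ^ A) →
      z ≤ ENNReal.ofReal (2 ^ B) → A + B ≤ 4 * (m + 1) - (1 / 2 + m * a + η - τ) * u →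
      x * z ≤ ENNReal.ofReal (2 ^ (4 * ((m : ℝ) + 1)) *
        (2 ^ (-u)) ^ (1 / 2 + m * a + η - τ)) := by
    intro A B x z hx hz h
    refine (mul_le_mul' hx hz).trans ?_
    rw [← ENNReal.ofReal_mul (by positivity), ← Real.rpow_add two_pos, ← Real.rpow_mul zero_le_two,
      ← Real.rpow_add two_pos]
    exact ENNReal.ofReal_le_ofReal
      (Real.rpow_le_rpow_of_exponent_le one_le_two (by linarith))
  rcases exponent_le hm ha ha' hε0.le hετ (hk j) hj1 hj2.le
    (by linarith [hk2 j, Nat.cast_nonneg (α := ℝ) g]) with h | h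
  · exact hcomb hA1 hB h
  · exact hcomb hA2 hB h

theorem mainTheorem5 (n : ℕ) (hn : 2 ≤ n) (a b : ℝ) (ha : 1 / 2 < a) (ha' : a ≤ 3 / 4)
    (hb : b = 2 * a - 1) (c : ℝ) (hc : 0 < c) (c₀ : ℝ) (hc₀ : 0 < c₀) :
    ENNReal.ofReal (1 / 2 + ((n : ℝ) - 1) * a + b) ≤
      dimH (divergenceSet n a b c ∩
        {x : EuclideanSpace ℝ (Fin n) | ∀ i, x i ∈ Set.Icc 0 c₀}) := by
  subst hb
  by_contra! hlt
  have hα := ENNReal.toReal_lt_of_lt_ofReal hlt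
  have hnn := ENNReal.toReal_nonneg (a := dimH (divergenceSet n a (2 * a - 1) c ∩
        {x : EuclideanSpace ℝ (Fin n) | ∀ i, x i ∈ Set.Icc 0 c₀}))
  set t := (dimH (divergenceSet n a (2 * a - 1) c ∩
        {x : EuclideanSpace ℝ (Fin n) | ∀ i, x i ∈ Set.Icc 0 c₀})).toReal with ht
  have h := le_dimH_divergenceSet hn ha ha' hc hc₀
    (τ := (1 / 2 + ((n : ℝ) - 1) * a + (2 * a - 1) - t) / 2) (by linarith) (by linarith)
  rw [ENNReal.ofReal_le_iff_le_toReal hlt.ne_top, ← ht] at h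
  linarith
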